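/- Let $g=\frac{\sqrt5-1}{2}$ and $\alpha\in\left[\frac12,g\right]$. For $x>0$ let $$A_\alpha(x)=\left|\frac1x-\left\lfloor\frac1x-\alpha+1\right\rfloor\right| ,$$ let $\beta^{(\alpha)}_{-1}(x)=1$ and $\beta^{(\alpha)}_{j}(x)=\prod_{i=0}^{j}A_\alpha^i(x)$ for $j\ge 0$. The $\alpha$-Wilton function $W_\alpha:\mathbb R\to\mathbb R$ is the function given, for irrational $x\in(0,\alpha)$, by $$W_\alpha(x)=\sum_{n=0}^{\infty}(-1)^n\,\beta^{(\alpha)}_{n-1}(x)\,\log\frac{1}{A_\alpha^n(x)}$$ wherever this series converges, and completed outside $(0,\alpha)$ by $W_\alpha(-x)=W_\alpha(x)$ for $x\in(0,1-\alpha)$ and by $W_\alpha(x+1)=W_\alpha(x)$; equivalently, $W_\alpha(x)$ is the sum of the series at the point $|x-\lfloor x-\alpha+1\rfloor|$. Theorem. For every $\alpha\in\left[\frac12,g\right]$, the series defining $W_\alpha(x)$ converges for Lebesgue-almost every $x\in\mathbb R$, and $W_\alpha\in\mathrm{BMO}(\mathbb R)$; that is, $W_\alpha$ is locally integrable on $\mathbb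 R$ and $$\sup_{a<b}\ \frac1{b-a}\int_a^b\left|W_\alpha(x)-(W_\alpha)_{[a,b]}\right|dx<\infty,\qquad (W_\alpha)_{[a,b]}=\frac1{b-a}\int_a^b W_\alpha(x)\,dx .$$ -/

import Mathlib

open Filter Topology MeasureTheory

noncomputable section

/-- The distance from `x` to the integer `⌊x - α + 1⌋`, that is, to the integer `m` with
`α - 1 ≤ x - m < α`. -/
def alphaFold (α x : ℝ) : ℝ :=
  |x - (⌊x - α + 1⌋ : ℝ)|

/-- The map of the `α`-continued fractions,
`A_α(x) = |1/x - ⌊1/x - α + 1⌋|`; the orbit of a rational number may reach `0`, where Lean's value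
`1 / 0 = 0` gives `A_α(0) = 0` for `1/2 ≤ α < 1`. -/
def alphaMap (α x : ℝ) : ℝ :=
  |1 / x - (⌊1 / x - α + 1⌋ : ℝ)|

/-- `alphaBeta α n x = x · A_α(x) · ⋯ · A_α^{n-1}(x)`; this is the product that is usually denoted
by `β_{n-1}^{(α)}(x)`, with the convention `β_{-1}^{(α)}(x) = 1`. -/
def alphaBeta (α : ℝ) (n : ℕ) (x : ℝ) : ℝ :=
  ∏ i ∈ Finset.range n, (alphaMap α)^[i] x

/-- The partial sum over `n < N` of the series
`∑_{n ≥ 0} (-1)^n β_{n-1}^{(α)}(x) log (1 / A_α^n(x))`. -/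
def wiltonPartialSum (α : ℝ) (N : ℕ) (x : ℝ) : ℝ :=
  ∑ n ∈ Finset.range N,
    (-1 : ℝ) ^ n * alphaBeta α n x * Real.log (1 / (alphaMap α)^[n] x)

/-- The `α`-Wilton function on the real line. On `(0, α)` it is the sum (limit of the partial sums)
of the series `∑_{n ≥ 0} (-1)^n β_{n-1}^{(α)}(x) log (1 / A_α^n(x))`. It is completed outside
`(0, α)` by `W_α(-x) = W_α(x)` for `0 < x ≤ 1 - α` and by periodicity with period `1`, that is,
`W_α(x)` is the sum of the series at the point `alphaFold α x`. -/
def wilton (α : ℝ) (x : ℝ) : ℝ :=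
  limUnder atTop (fun N : ℕ => wiltonPartialSum α N (alphaFold α x))

/-- The mean value of `f` on the interval with end points `a < b`. -/
def meanValue (f : ℝ → ℝ) (a b : ℝ) : ℝ :=
  1 / (b - a) * ∫ x in a..b, f x

/-- `f` belongs to `BMO(ℝ)`: it is locally integrable, and its mean oscillations over the bounded
intervals are bounded by one constant. -/
def IsBMO (f : ℝ → ℝ) : Prop :=
  LocallyIntegrable f volume ∧
    ∃ C : ℝ, ∀ a b : ℝ, a < b → meanValue (fun x => |f x - meanValue f a b|) a b ≤ C

end

/-!
The proof rests on the functional equation `W(x) = - log x - x W(1 / x)` on `(0, α)`, where `W` is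
the `α`-Wilton function, extended to the real line.

*Convergence.* The operator `f ↦ x f(A_α(x))` contracts the `L¹` norm
(`lintegral_wiltonTerm_succ_le`): after the substitution `y = 1 / x` it is an integral of a
function of period `1` against the weight `y⁻³` on `(1 / α, ∞)`. So the series converges absolutely
in `L¹`, hence almost everywhere.

*Reduction to an even function.* For `1 / 2 < x < α` the second iterates of `x` and `1 - x` agree,
because `α² + α ≤ 1`, and `W(x) - W(1 - x)` is an explicit bounded function
(`abs_wiltonSum_sub_reflect_le`). Therefore `W` differs by a bounded function from the even function
`G` of period `1` that agrees with `W` on `(0, 1 / 2)`, and `G(t) + log t + t G(1 / t)` is bounded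
on `(0, 1 / 2)`.

*Bounded mean oscillation of `G`.* Intervals with end point `0` are estimated directly: there the
weight `y⁻³` bounds the mean of `t |G(1 / t)|` (`WiltonEquation.hasOsc_zero`). By periodicity and
evenness this covers all intervals that contain an integer, and since `1 / t` maps `1 / 2` to the
integer `2`, also those that contain a half-integer. Any other short interval may be moved into
`(0, 1 / 2)`. If the ratio of its end points is large it is comparable to an interval with end
point `0`. Otherwise `x ↦ 1 / x` maps it to an interval at least four times as long, and the factor
`x ≤ 1 / 2` makes the oscillation over the short interval at most `11 / 12` of the oscillation over
the long one, up to a constant (`WiltonEquation.hasOsc_of_inv`). Induction on the scale gives one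
bound for all intervals.
-/

open Set ENNReal

/-! ### Periodic functions and the substitution `y = 1 / x` -/

theorem lintegral_Ioc_periodic_eq {U : ℝ → ℝ≥0∞} (hU : Function.Periodic U 1) (s t : ℝ) :
    ∫⁻ x in Ioc s (s + 1), U x = ∫⁻ x in Ioc t (t + 1), U x := by
  refine (isAddFundamentalDomain_Ioc one_pos s).setLIntegral_eq
    (isAddFundamentalDomain_Ioc one_pos t) U ?_
  rintro ⟨g, hg⟩ x
  obtain ⟨n, rfl⟩ := AddSubgroup.mem_zmultiples_iff.1 hg
  change U (n • (1 : ℝ) + x) = U x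
  rw [add_comm]
  exact hU.zsmul n x

theorem lintegral_Ioc_periodic_le {U : ℝ → ℝ≥0∞} (hU : Function.Periodic U 1) {a b : ℝ}
    (hab : a ≤ b) :
    ∫⁻ x in Ioc a b, U x ≤ ENNReal.ofReal (b - a + 1) * ∫⁻ x in Ioc 0 1, U x := by
  have key : ∀ n : ℕ, ∫⁻ x in Ioc a (a + n), U x ≤ n * ∫⁻ x in Ioc 0 1, U x := by
    intro n
    induction n with
    | zero => simp
    | succ n ih =>
      have h1 : Ioc a (a + (n + 1 : ℕ)) ⊆ Ioc a (a + n) ∪ Ioc (a + n) (a + n + 1) := by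
        intro x hx
        rcases le_or_gt x (a + n) with h | h
        · exact Or.inl ⟨hx.1, h⟩
        · refine Or.inr ⟨h, ?_⟩
          have := hx.2
          push_cast at this
          linarith
      calc _ ≤ ∫⁻ x in Ioc a (a + n) ∪ Ioc (a + n) (a + n + 1), U x := lintegral_mono_set h1
        _ ≤ _ := lintegral_union_le _ _ _
        _ ≤ (n * ∫⁻ x in Ioc 0 1, U x) + ∫⁻ x in Ioc 0 1, U x := by
            refine add_le_add ih (le_of_eq ?_)
            simpa using lintegral_Ioc_periodic_eq hU (a + n) 0
        _ = _ := by push_cast; ring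
  have hn : (⌈b - a⌉₊ : ℝ) ≤ b - a + 1 := (Nat.ceil_lt_add_one (by linarith)).le
  calc ∫⁻ x in Ioc a b, U x ≤ ∫⁻ x in Ioc a (a + ⌈b - a⌉₊), U x := by
        refine lintegral_mono_set (Ioc_subset_Ioc_right ?_)
        linarith [Nat.le_ceil (b - a)]
    _ ≤ _ := key _
    _ ≤ _ := by
        gcongr
        rw [← ENNReal.ofReal_natCast]
        exact ENNReal.ofReal_le_ofReal hn

theorem sum_inv_cube_le {c : ℝ} (hc : 0 < c) (n : ℕ) :
    ∑ k ∈ Finset.range n, ((c + k) ^ 3)⁻¹ ≤ (c ^ 3)⁻¹ + 1 / (2 * c * (c + 1)) := by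
  -- the summands with `k ≥ 1` are dominated by a telescoping sum
  have key : ∀ n : ℕ, ∑ k ∈ Finset.range (n + 1), ((c + k) ^ 3)⁻¹ ≤
      (c ^ 3)⁻¹ + 1 / (2 * c * (c + 1)) - 1 / (2 * (c + n) * (c + n + 1)) := by
    intro n
    induction n with
    | zero => simp
    | succ n ih =>
      rw [Finset.sum_range_succ]
      have hx : 0 < c + n := by positivity
      have h : ((c + (n + 1 : ℕ)) ^ 3)⁻¹ ≤ 1 / (2 * (c + n) * (c + n + 1)) -
          1 / (2 * (c + (n + 1 : ℕ)) * (c + (n + 1 : ℕ) + 1)) := by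
        push_cast
        rw [← add_assoc]
        generalize c + (n : ℝ) = x at hx
        have e : 1 / (2 * x * (x + 1)) - 1 / (2 * (x + 1) * (x + 1 + 1)) =
            (x * (x + 1) * (x + 2))⁻¹ := by
          field_simp
          ring
        rw [e]
        exact inv_anti₀ (by positivity) (by nlinarith)
      linarith
  rcases n with _ | n
  · simp; positivity
  · have h := key n
    have : 0 ≤ 1 / (2 * (c + n) * (c + n + 1)) := by positivity
    linarith

/-- The weight `y⁻³` is replaced by its maximum on each of the unit intervals that start at
`c, c + 1, …`. -/
theorem lintegral_Ioi_inv_cube_mul_le {U : ℝ → ℝ≥0∞} (hU : Function.Periodic U 1) {c : ℝ}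
    (hc : 0 < c) :
    ∫⁻ y in Ioi c, ENNReal.ofReal ((y ^ 3)⁻¹) * U y ≤
      ENNReal.ofReal ((c ^ 3)⁻¹ + 1 / (2 * c * (c + 1))) * ∫⁻ x in Ioc 0 1, U x := by
  have hcov : Ioi c ⊆ ⋃ k : ℕ, Ioc (c + k) (c + k + 1) := by
    intro x hx
    have hx' : c < x := hx
    have h1 : 0 < ⌈x - c⌉₊ := Nat.ceil_pos.2 (by linarith)
    refine mem_iUnion.2 ⟨⌈x - c⌉₊ - 1, ?_⟩
    have h2 := Nat.ceil_lt_add_one (show 0 ≤ x - c by linarith)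
    have h3 := Nat.le_ceil (x - c)
    rw [mem_Ioc, Nat.cast_sub h1]
    push_cast
    constructor <;> linarith
  calc _ ≤ ∫⁻ y in ⋃ k : ℕ, Ioc (c + k) (c + k + 1), ENNReal.ofReal ((y ^ 3)⁻¹) * U y :=
        lintegral_mono_set hcov
    _ ≤ ∑' k : ℕ, ∫⁻ y in Ioc (c + k) (c + k + 1), ENNReal.ofReal ((y ^ 3)⁻¹) * U y :=
        lintegral_iUnion_le _ _
    _ ≤ ∑' k : ℕ, ENNReal.ofReal (((c + k) ^ 3)⁻¹) * ∫⁻ x in Ioc 0 1, U x := by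
        refine ENNReal.tsum_le_tsum fun k => ?_
        have e := lintegral_Ioc_periodic_eq hU (c + k) 0
        rw [zero_add] at e
        rw [← e, ← lintegral_const_mul' _ _ ENNReal.ofReal_ne_top]
        refine setLIntegral_mono' measurableSet_Ioc fun y hy => ?_
        have : 0 < c + k := by positivity
        gcongr
        exact hy.1.le
    _ = (∑' k : ℕ, ENNReal.ofReal (((c + k) ^ 3)⁻¹)) * ∫⁻ x in Ioc 0 1, U x :=
        ENNReal.tsum_mul_right
    _ ≤ _ := by
        gcongr
        refine ENNReal.tsum_le_of_sum_range_le fun n => ?_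
        rw [← ENNReal.ofReal_sum_of_nonneg fun k _ => by positivity]
        exact ENNReal.ofReal_le_ofReal (sum_inv_cube_le hc n)

/-- The substitution `y = 1 / x`. -/
theorem lintegral_mul_comp_inv (U : ℝ → ℝ≥0∞) {s : Set ℝ} (hs : MeasurableSet s)
    (hpos : ∀ x ∈ s, 0 < x) :
    ∫⁻ x in s, ENNReal.ofReal x * U (1 / x) =
      ∫⁻ y in (fun x : ℝ => x⁻¹) '' s, ENNReal.ofReal ((y ^ 3)⁻¹) * U y := by
  rw [lintegral_image_eq_lintegral_abs_deriv_mul hs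
    (fun x hx => (hasDerivAt_inv (hpos x hx).ne').hasDerivWithinAt) inv_injective.injOn]
  refine setLIntegral_congr_fun hs fun x hx => ?_
  have := hpos x hx
  rw [← mul_assoc, ← ENNReal.ofReal_mul (abs_nonneg _), one_div]
  congr 2
  rw [abs_neg, abs_of_pos (by positivity)]
  field_simp

/-! ### Oscillation over an interval -/

/-- The mean oscillation of `G` over `[a, b]`, measured from a suitable constant instead of the
mean value, is at most `K`. -/
def HasOsc (G : ℝ → ℝ) (K a b : ℝ) : Prop :=
  ∃ c : ℝ, ∫⁻ x in Icc a b, ‖G x - c‖ₑ ≤ ENNReal.ofReal (K * (b - a))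

theorem HasOsc.of_subset {G : ℝ → ℝ} {K K' a b a' b' : ℝ} (h : HasOsc G K a b) (ha : a ≤ a')
    (hb : b' ≤ b) (hK : K * (b - a) ≤ K' * (b' - a')) : HasOsc G K' a' b' := by
  obtain ⟨c, hc⟩ := h
  exact ⟨c, (lintegral_mono_set (Icc_subset_Icc ha hb)).trans
    (hc.trans (ENNReal.ofReal_le_ofReal hK))⟩

theorem HasOsc.mono {G : ℝ → ℝ} {K K' a b : ℝ} (h : HasOsc G K a b) (hab : a ≤ b)
    (hK : K ≤ K') : HasOsc G K' a b :=
  h.of_subset le_rfl le_rfl (mul_le_mul_of_nonneg_right hK (by linarith))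

theorem HasOsc.of_translate {G : ℝ → ℝ} (hG : Function.Periodic G 1) {K a b : ℝ} (n : ℤ)
    (h : HasOsc G K (a + n) (b + n)) : HasOsc G K a b := by
  obtain ⟨c, hc⟩ := h
  refine ⟨c, ?_⟩
  have e := (measurePreserving_add_right volume (n : ℝ)).setLIntegral_comp_preimage_emb
    (measurableEmbedding_addRight (n : ℝ)) (fun x => ‖G x - c‖ₑ) (Icc (a + n) (b + n))
  have hp : (fun x : ℝ => x + n) ⁻¹' Icc (a + n) (b + n) = Icc a b := by ext; simp
  have hGn : ∀ x, G (x + n) = G x := fun x => by simpa using hG.int_mul n x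
  simp only [hp, hGn] at e
  rw [e]
  simpa using hc

theorem setLIntegral_Icc_reflect (U : ℝ → ℝ≥0∞) (m a b : ℝ) :
    ∫⁻ x in Icc (m - b) (m - a), U (m - x) = ∫⁻ x in Icc a b, U x := by
  have e := (Measure.measurePreserving_sub_left volume m).setLIntegral_comp_preimage_emb
    (MeasurableEquiv.subLeft m).measurableEmbedding U (Icc a b)
  have hp : (fun x : ℝ => m - x) ⁻¹' Icc a b = Icc (m - b) (m - a) := by
    ext x
    simp only [mem_preimage, mem_Icc]
    constructor <;> rintro ⟨h1, h2⟩ <;> constructor <;> linarith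
  rw [hp] at e
  exact e

theorem HasOsc.of_reflect {G : ℝ → ℝ} {m : ℝ} (hG : ∀ x, G (m - x) = G x) {K a b : ℝ}
    (h : HasOsc G K (m - b) (m - a)) : HasOsc G K a b := by
  obtain ⟨c, hc⟩ := h
  refine ⟨c, ?_⟩
  have e := setLIntegral_Icc_reflect (fun x => ‖G x - c‖ₑ) m a b
  simp only [hG] at e
  rw [← e]
  convert hc using 2
  ring

theorem HasOsc.symmetrize {G : ℝ → ℝ} {m : ℝ} (hG : ∀ x, G (2 * m - x) = G x) {K s : ℝ}
    (hs : 0 ≤ s) (hK : 0 ≤ K) (h : HasOsc G K (m - s) m) : HasOsc G K (m - s) (m + s) := by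
  obtain ⟨c, hc⟩ := h
  refine ⟨c, ?_⟩
  have e := setLIntegral_Icc_reflect (fun x => ‖G x - c‖ₑ) (2 * m) (m - s) m
  simp only [hG] at e
  rw [show 2 * m - m = m by ring, show 2 * m - (m - s) = m + s by ring] at e
  have hu : Icc (m - s) (m + s) = Icc (m - s) m ∪ Icc m (m + s) :=
    (Icc_union_Icc_eq_Icc (by linarith) (by linarith)).symm
  rw [hu]
  refine (lintegral_union_le _ _ _).trans ?_
  rw [e]
  refine (add_le_add hc hc).trans ?_
  rw [← ENNReal.ofReal_add (by nlinarith) (by nlinarith)]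
  exact ENNReal.ofReal_le_ofReal (by nlinarith)

/-! ### Functions with `G t + t G (1 / t) = - log t` up to a bounded error -/

/-- The hypotheses under which an even function of period `1` is shown to have bounded mean
oscillation: it is integrable over a period, and it satisfies the functional equation
`G t + t G (1 / t) = - log t` on `(0, 1 / 2)` up to a bounded error. -/
structure WiltonEquation (G : ℝ → ℝ) (M H : ℝ) : Prop where
  measurable : Measurable G
  periodic : Function.Periodic G 1
  even : ∀ x, G (-x) = G x
  nonneg_M : 0 ≤ M
  nonneg_H : 0 ≤ H
  lintegral_le : ∫⁻ x in Ioc 0 1, ‖G x‖ₑ ≤ ENNReal.ofReal M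
  equation : ∀ᵐ t : ℝ, t ∈ Ioo 0 (1 / 2) → |G t + Real.log t + t * G (1 / t)| ≤ H

theorem lintegral_log_sub_log {b : ℝ} (hb : 0 < b) :
    ∫⁻ x in Ioc 0 b, ENNReal.ofReal (Real.log b - Real.log x) = ENNReal.ofReal b := by
  have hi : IntervalIntegrable (fun x => Real.log b - Real.log x) volume 0 b :=
    intervalIntegrable_const.sub intervalIntegral.intervalIntegrable_log'
  rw [← ofReal_integral_eq_lintegral_ofReal, ← intervalIntegral.integral_of_le hb.le,
    intervalIntegral.integral_sub intervalIntegrable_const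
      intervalIntegral.intervalIntegrable_log', integral_log]
  · simp
  · exact (intervalIntegrable_iff_integrableOn_Ioc_of_le hb.le).1 hi
  · refine (ae_restrict_iff' measurableSet_Ioc).2 (ae_of_all _ fun x hx => ?_)
    have := Real.log_le_log hx.1 hx.2
    simpa using this

theorem enorm_le_ofReal {x r : ℝ} (h : |x| ≤ r) : ‖x‖ₑ ≤ ENNReal.ofReal r := by
  rw [Real.enorm_eq_ofReal_abs]
  exact ENNReal.ofReal_le_ofReal h

namespace WiltonEquation

variable {G : ℝ → ℝ} {M H : ℝ}

theorem lintegral_Icc_le (h : WiltonEquation G M H) {a b : ℝ} (hab : a ≤ b) :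
    ∫⁻ x in Icc a b, ‖G x‖ₑ ≤ ENNReal.ofReal ((b - a + 1) * M) := by
  rw [setLIntegral_congr Ioc_ae_eq_Icc.symm, ENNReal.ofReal_mul (by linarith)]
  have hp : Function.Periodic (fun x => ‖G x‖ₑ) 1 := fun x => by simp [h.periodic x]
  exact (lintegral_Ioc_periodic_le hp hab).trans (by gcongr; exact h.lintegral_le)

theorem hasOsc_of_large (h : WiltonEquation G M H) {a b : ℝ} (hab : 1 / 10 ≤ b - a) :
    HasOsc G (11 * M) a b := by
  refine ⟨0, ?_⟩
  simp only [sub_zero]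
  refine (h.lintegral_Icc_le (by linarith)).trans (ENNReal.ofReal_le_ofReal ?_)
  nlinarith [h.nonneg_M]

/-- Near `0` the function differs from the logarithm by a function whose means are bounded: in
`∫ t |G (1 / t)| dt` the substitution `y = 1 / t` produces the integrable weight `y⁻³`. -/
theorem hasOsc_zero (h : WiltonEquation G M H) {b : ℝ} (hb : 0 < b) (hb2 : b ≤ 1 / 2) :
    HasOsc G (1 + H + M) 0 b := by
  have hM := h.nonneg_M
  have hH := h.nonneg_H
  refine ⟨-Real.log b, ?_⟩
  rw [setLIntegral_congr Ioc_ae_eq_Icc.symm]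
  have hp : Function.Periodic (fun x => ‖G x‖ₑ) 1 := fun x => by simp [h.periodic x]
  have hpt : ∀ᵐ x ∂volume.restrict (Ioc 0 b), ‖G x - -Real.log b‖ₑ ≤
      ENNReal.ofReal (Real.log b - Real.log x) +
        (ENNReal.ofReal H + ENNReal.ofReal x * ‖G (1 / x)‖ₑ) := by
    refine (ae_restrict_iff' measurableSet_Ioc).2 ?_
    filter_upwards [h.equation, (measure_singleton (μ := volume) (1 / 2 : ℝ) :
      volume {(1 / 2 : ℝ)} = 0) |> measure_eq_zero_iff_ae_notMem.1] with x hx hx2 hxb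
    have hxne : x ≠ 1 / 2 := by simpa using hx2
    have hxlt : x < 1 / 2 := lt_of_le_of_ne (hxb.2.trans hb2) hxne
    have h1 := hx ⟨hxb.1, hxlt⟩
    have h2 := Real.log_le_log hxb.1 hxb.2
    rw [Real.enorm_eq_ofReal_abs (G (1 / x)), ← ENNReal.ofReal_mul hxb.1.le,
      ← ENNReal.ofReal_add hH (mul_nonneg hxb.1.le (abs_nonneg _)),
      ← ENNReal.ofReal_add (by linarith)
        (add_nonneg hH (mul_nonneg hxb.1.le (abs_nonneg _)))]
    apply enorm_le_ofReal
    have e : G x - -Real.log b = (Real.log b - Real.log x) +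
        ((G x + Real.log x + x * G (1 / x)) + - (x * G (1 / x))) := by ring
    rw [e]
    refine (abs_add_le _ _).trans (add_le_add (abs_of_nonneg (by linarith)).le ?_)
    refine (abs_add_le _ _).trans (add_le_add h1 ?_)
    rw [abs_neg, abs_mul, abs_of_pos hxb.1]
  have hinv : ∫⁻ x in Ioc 0 b, ENNReal.ofReal x * ‖G (1 / x)‖ₑ ≤ ENNReal.ofReal (b * M) := by
    rw [lintegral_mul_comp_inv (fun x => ‖G x‖ₑ) measurableSet_Ioc fun x hx => hx.1]
    calc _ ≤ ∫⁻ y in Ici b⁻¹, ENNReal.ofReal ((y ^ 3)⁻¹) * ‖G y‖ₑ := by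
          refine lintegral_mono_set ?_
          rintro _ ⟨x, hx, rfl⟩
          exact inv_anti₀ hx.1 hx.2
      _ = ∫⁻ y in Ioi b⁻¹, ENNReal.ofReal ((y ^ 3)⁻¹) * ‖G y‖ₑ :=
          setLIntegral_congr Ioi_ae_eq_Ici.symm
      _ ≤ _ := lintegral_Ioi_inv_cube_mul_le hp (inv_pos.2 hb)
      _ ≤ ENNReal.ofReal b * ENNReal.ofReal M := by
          refine mul_le_mul' (ENNReal.ofReal_le_ofReal ?_) h.lintegral_le
          have h1 : ((b⁻¹) ^ 3)⁻¹ = b ^ 3 := by simp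
          have h2 : 1 / (2 * b⁻¹ * (b⁻¹ + 1)) ≤ b / 2 := by
            rw [div_le_iff₀ (by positivity)]
            field_simp
            linarith
          rw [h1]
          nlinarith [mul_pos hb hb]
      _ = _ := (ENNReal.ofReal_mul hb.le).symm
  calc _ ≤ ∫⁻ x in Ioc 0 b, (ENNReal.ofReal (Real.log b - Real.log x) +
        (ENNReal.ofReal H + ENNReal.ofReal x * ‖G (1 / x)‖ₑ)) := lintegral_mono_ae hpt
    _ = ENNReal.ofReal b + (ENNReal.ofReal H * ENNReal.ofReal b +
        ∫⁻ x in Ioc 0 b, ENNReal.ofReal x * ‖G (1 / x)‖ₑ) := by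
        rw [lintegral_add_left (by fun_prop), lintegral_add_left measurable_const,
          lintegral_log_sub_log hb, setLIntegral_const, Real.volume_Ioc, sub_zero]
    _ ≤ ENNReal.ofReal b + (ENNReal.ofReal H * ENNReal.ofReal b + ENNReal.ofReal (b * M)) := by
        gcongr
    _ = _ := by
        rw [← ENNReal.ofReal_mul hH, ← ENNReal.ofReal_add (by positivity) (by positivity),
          ← ENNReal.ofReal_add (by positivity) (by positivity)]
        congr 1
        ring

/-- The constant from which the oscillation over an interval is measured cannot be large. -/
theorem abs_const_mul_le (h : WiltonEquation G M H) {K p q c : ℝ} (hpq : p ≤ q) (hK : 0 ≤ K)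
    (hc : ∫⁻ x in Icc p q, ‖G x - c‖ₑ ≤ ENNReal.ofReal (K * (q - p))) :
    |c| * (q - p) ≤ K * (q - p) + (q - p + 1) * M := by
  have hM := h.nonneg_M
  have hqp : 0 ≤ q - p := by linarith
  rw [← ENNReal.ofReal_le_ofReal_iff (by positivity), ENNReal.ofReal_add (by positivity)
    (by positivity)]
  calc ENNReal.ofReal (|c| * (q - p)) = ∫⁻ _ in Icc p q, ‖c‖ₑ := by
        rw [setLIntegral_const, Real.volume_Icc, Real.enorm_eq_ofReal_abs,
          ENNReal.ofReal_mul (abs_nonneg _)]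
    _ ≤ ∫⁻ x in Icc p q, (‖G x - c‖ₑ + ‖G x‖ₑ) := by
        refine lintegral_mono fun x => ?_
        have e : c = -(G x - c) + G x := by ring
        calc ‖c‖ₑ = ‖-(G x - c) + G x‖ₑ := by rw [← e]
          _ ≤ _ := (enorm_add_le _ _).trans (by rw [enorm_neg])
    _ = (∫⁻ x in Icc p q, ‖G x - c‖ₑ) + ∫⁻ x in Icc p q, ‖G x‖ₑ :=
        lintegral_add_right _ h.measurable.enorm
    _ ≤ _ := add_le_add hc (h.lintegral_Icc_le hpq)

/-- Pulling back along `x ↦ 1 / x`. On an interval `[a, b]` of bounded ratio the weight `x ≤ 1 / 2`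
in the functional equation outweighs the distortion of the substitution, so that the oscillation
contracts. -/
theorem hasOsc_of_inv (h : WiltonEquation G M H) {K a b : ℝ} (ha : 0 < a) (hab : a < b)
    (hb : b ≤ 1 / 2) (hba : b ≤ 3 / 2 * a) (hK : 0 ≤ K) (hosc : HasOsc G K b⁻¹ a⁻¹) :
    HasOsc G (11 / 12 * K + (1 + H + M)) a b := by
  -- `11 / 12 = 3 / 4 + 1 / 6`: the first part comes from `x (G (1 / x) - c)`, the second one from
  -- the variation of the weight `x` in front of the constant `c`
  have hM := h.nonneg_M
  have hH := h.nonneg_H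
  have hb0 : 0 < b := ha.trans hab
  obtain ⟨c, hc⟩ := hosc
  have hcle : |c| * (b - a) ≤ M + K / 6 := by
    have h1 := h.abs_const_mul_le (inv_anti₀ ha hab.le) hK hc
    have e : a⁻¹ - b⁻¹ = (b - a) / (a * b) := by field_simp
    have h2 := mul_le_mul_of_nonneg_right h1 (mul_pos ha hb0).le
    have h3 : |c| * (a⁻¹ - b⁻¹) * (a * b) = |c| * (b - a) := by rw [e]; field_simp
    have h4 : (K * (a⁻¹ - b⁻¹) + (a⁻¹ - b⁻¹ + 1) * M) * (a * b) =
        K * (b - a) + (b - a + a * b) * M := by rw [e]; field_simp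
    rw [h3, h4] at h2
    have h5 : K * (b - a) ≤ K * (1 / 6) := mul_le_mul_of_nonneg_left (by linarith) hK
    have h6 : (b - a + a * b) * M ≤ 1 * M := mul_le_mul_of_nonneg_right (by nlinarith) hM
    linarith
  have hlog : Real.log b - Real.log a ≤ 1 / 2 := by
    rw [← Real.log_div hb0.ne' ha.ne']
    have h1 := Real.log_le_sub_one_of_pos (div_pos hb0 ha)
    have h2 : b / a ≤ 3 / 2 := (div_le_iff₀ ha).2 hba
    linarith
  refine ⟨-Real.log b - a * c, ?_⟩
  have hR : 0 ≤ 1 / 2 + H + (M + K / 6) := by positivity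
  have hpt : ∀ᵐ x ∂volume.restrict (Icc a b), ‖G x - (-Real.log b - a * c)‖ₑ ≤
      ENNReal.ofReal (1 / 2 + H + (M + K / 6)) + ENNReal.ofReal x * ‖G (1 / x) - c‖ₑ := by
    refine (ae_restrict_iff' measurableSet_Icc).2 ?_
    filter_upwards [h.equation, (measure_singleton (μ := volume) (1 / 2 : ℝ) :
      volume {(1 / 2 : ℝ)} = 0) |> measure_eq_zero_iff_ae_notMem.1] with x hx hx2 hxb
    have hxne : x ≠ 1 / 2 := by simpa using hx2
    have hxlt : x < 1 / 2 := lt_of_le_of_ne (hxb.2.trans hb) hxne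
    have hx0 : 0 < x := ha.trans_le hxb.1
    have h1 := hx ⟨hx0, hxlt⟩
    have h2 := Real.log_le_log hx0 hxb.2
    have h3 := Real.log_le_log ha hxb.1
    rw [Real.enorm_eq_ofReal_abs (G (1 / x) - c), ← ENNReal.ofReal_mul hx0.le,
      ← ENNReal.ofReal_add hR (mul_nonneg hx0.le (abs_nonneg _))]
    apply enorm_le_ofReal
    have e : G x - (-Real.log b - a * c) = (Real.log b - Real.log x) +
        (G x + Real.log x + x * G (1 / x)) + -((x - a) * c) + -(x * (G (1 / x) - c)) := by ring
    rw [e]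
    refine (abs_add_le _ _).trans (add_le_add ?_ ?_)
    · refine (abs_add_le _ _).trans (add_le_add ((abs_add_le _ _).trans (add_le_add ?_ h1)) ?_)
      · rw [abs_of_nonneg (by linarith)]
        linarith
      · rw [abs_neg, abs_mul, abs_of_nonneg (by linarith [hxb.1]), mul_comm]
        exact (mul_le_mul_of_nonneg_left (by linarith [hxb.2]) (abs_nonneg c)).trans hcle
    · rw [abs_neg, abs_mul, abs_of_pos hx0]
  have hinv : ∫⁻ x in Icc a b, ENNReal.ofReal x * ‖G (1 / x) - c‖ₑ ≤
      ENNReal.ofReal (3 / 4 * K * (b - a)) := by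
    rw [lintegral_mul_comp_inv (fun x => ‖G x - c‖ₑ) measurableSet_Icc
      fun x hx => ha.trans_le hx.1]
    calc _ ≤ ∫⁻ y in Icc b⁻¹ a⁻¹, ENNReal.ofReal ((y ^ 3)⁻¹) * ‖G y - c‖ₑ := by
          refine lintegral_mono_set ?_
          rintro _ ⟨x, hx, rfl⟩
          exact ⟨inv_anti₀ (ha.trans_le hx.1) hx.2, inv_anti₀ ha hx.1⟩
      _ ≤ ∫⁻ y in Icc b⁻¹ a⁻¹, ENNReal.ofReal (b ^ 3) * ‖G y - c‖ₑ := by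
          refine setLIntegral_mono' measurableSet_Icc fun y hy => ?_
          gcongr
          rw [← inv_pow]
          have : y⁻¹ ≤ b := by simpa using inv_anti₀ (inv_pos.2 hb0) hy.1
          have hy0 : 0 < y := (inv_pos.2 hb0).trans_le hy.1
          gcongr
      _ = ENNReal.ofReal (b ^ 3) * ∫⁻ y in Icc b⁻¹ a⁻¹, ‖G y - c‖ₑ :=
          lintegral_const_mul' _ _ ENNReal.ofReal_ne_top
      _ ≤ ENNReal.ofReal (b ^ 3) * ENNReal.ofReal (K * (a⁻¹ - b⁻¹)) := by gcongr
      _ = ENNReal.ofReal (b ^ 3 * (K * (a⁻¹ - b⁻¹))) :=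
          (ENNReal.ofReal_mul (by positivity)).symm
      _ ≤ _ := by
          refine ENNReal.ofReal_le_ofReal ?_
          have e : b ^ 3 * (K * (a⁻¹ - b⁻¹)) = b * (b / a) * (K * (b - a)) := by field_simp
          have h2 : b / a ≤ 3 / 2 := (div_le_iff₀ ha).2 hba
          have h3 : b * (b / a) ≤ 1 / 2 * (3 / 2) :=
            mul_le_mul hb h2 (by positivity) (by norm_num)
          have h4 : 0 ≤ K * (b - a) := mul_nonneg hK (by linarith)
          rw [e]
          nlinarith
  calc _ ≤ ∫⁻ x in Icc a b, (ENNReal.ofReal (1 / 2 + H + (M + K / 6)) +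
        ENNReal.ofReal x * ‖G (1 / x) - c‖ₑ) := lintegral_mono_ae hpt
    _ = ENNReal.ofReal (1 / 2 + H + (M + K / 6)) * ENNReal.ofReal (b - a) +
        ∫⁻ x in Icc a b, ENNReal.ofReal x * ‖G (1 / x) - c‖ₑ := by
        rw [lintegral_add_left measurable_const, setLIntegral_const, Real.volume_Icc]
    _ ≤ ENNReal.ofReal (1 / 2 + H + (M + K / 6)) * ENNReal.ofReal (b - a) +
        ENNReal.ofReal (3 / 4 * K * (b - a)) := by gcongr
    _ ≤ _ := by
        have h0 : 0 ≤ b - a := by linarith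
        rw [← ENNReal.ofReal_mul hR, ← ENNReal.ofReal_add (by positivity) (by positivity)]
        refine ENNReal.ofReal_le_ofReal ?_
        rw [← add_mul]
        exact mul_le_mul_of_nonneg_right (by linarith) h0

theorem hasOsc_of_zero_mem (h : WiltonEquation G M H) {a b : ℝ} (ha : a ≤ 0) (hb : 0 ≤ b)
    (hab : a < b) (hl : b - a ≤ 1 / 10) : HasOsc G (2 * (1 + H + M)) a b := by
  have hC : 0 ≤ 1 + H + M := by linarith [h.nonneg_M, h.nonneg_H]
  have h1 : HasOsc G (1 + H + M) (0 - (b - a)) 0 := by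
    refine HasOsc.of_reflect (m := 0) (fun x => by simpa using h.even x) ?_
    simpa using h.hasOsc_zero (b := b - a) (by linarith) (by linarith)
  refine (h1.symmetrize (fun x => by simpa using h.even x) (by linarith) hC).of_subset
    (by linarith) (by linarith) (le_of_eq ?_)
  ring

theorem reflect_one (h : WiltonEquation G M H) (x : ℝ) : G (1 - x) = G x := by
  rw [show 1 - x = -x + 1 by ring, h.periodic, h.even]

/-- The map `x ↦ 1 / x` sends a neighbourhood of `1 / 2` to a neighbourhood of the integer `2`. -/
theorem hasOsc_of_half_mem (h : WiltonEquation G M H) {a b : ℝ} (ha : a ≤ 1 / 2)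
    (hb : 1 / 2 ≤ b) (hab : a < b) (hl : b - a ≤ 1 / 10) :
    HasOsc G (4 * (1 + H + M)) a b := by
  have hC : 0 ≤ 1 + H + M := by linarith [h.nonneg_M, h.nonneg_H]
  have hs0 : 0 < 1 / 2 - (b - a) := by linarith
  have hinv1 : 2 < (1 / 2 - (b - a))⁻¹ := by
    rw [lt_inv_comm₀ (by norm_num) hs0]
    linarith
  have hinv2 : (1 / 2 - (b - a))⁻¹ ≤ 2 + 1 / 2 := by
    rw [inv_le_comm₀ hs0 (by norm_num)]
    norm_num
    linarith
  have h0 : HasOsc G (1 + H + M) (1 / 2)⁻¹ (1 / 2 - (b - a))⁻¹ := by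
    refine HasOsc.of_translate h.periodic (-2) ?_
    have := h.hasOsc_zero (b := (1 / 2 - (b - a))⁻¹ - 2) (by linarith) (by linarith)
    convert this using 1 <;> norm_num
    ring
  have h1 : HasOsc G (2 * (1 + H + M)) (1 / 2 - (b - a)) (1 / 2) :=
    (h.hasOsc_of_inv hs0 (by linarith) le_rfl (by linarith) hC h0).mono (by linarith)
      (by linarith)
  refine (h1.symmetrize (fun x => by simpa using h.reflect_one x) (by linarith)
    (by linarith)).of_subset (by linarith) (by linarith) (le_of_eq ?_)
  ring

/-- The step of the induction on scales: for an interval inside `(0, 1 / 2)`, the image under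
`x ↦ 1 / x` is at least four times as long. -/
theorem hasOsc_of_mem_Ioo (h : WiltonEquation G M H) {r : ℝ}
    (ih : ∀ a b, a < b → 4 * r ≤ b - a → HasOsc G (12 * (1 + H + M)) a b) {a b : ℝ} (ha : 0 < a)
    (hab : a < b) (hb : b < 1 / 2) (hl : r ≤ b - a) : HasOsc G (12 * (1 + H + M)) a b := by
  have hC : 0 ≤ 1 + H + M := by linarith [h.nonneg_M, h.nonneg_H]
  have hb0 : 0 < b := ha.trans hab
  rcases le_or_gt b (3 / 2 * a) with hba | hba
  · have hlen : 4 * (b - a) ≤ a⁻¹ - b⁻¹ := by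
      have e : a⁻¹ - b⁻¹ = (b - a) / (a * b) := by field_simp
      rw [e, le_div_iff₀ (by positivity)]
      have : a * b ≤ 1 / 4 := by nlinarith
      nlinarith
    refine (h.hasOsc_of_inv ha hab hb.le hba (by linarith) (ih _ _ ?_ ?_)).mono hab.le ?_
    · exact inv_strictAnti₀ ha hab
    · linarith
    · linarith
  · exact (h.hasOsc_zero hb0 hb.le).of_subset ha.le le_rfl (by nlinarith)

/-- The constant `12 C` is the fixed point of `K ↦ 11 / 12 * K + C`. Intervals that contain an
integer or a half-integer, and long intervals, are settled without the induction on scales. -/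
theorem hasOsc (h : WiltonEquation G M H) {a b : ℝ} (hab : a < b) :
    HasOsc G (12 * (1 + H + M)) a b := by
  have hM := h.nonneg_M
  have hH := h.nonneg_H
  have key : ∀ n : ℕ, ∀ a b : ℝ, a < b → 1 / 10 * (1 / 4 : ℝ) ^ n ≤ b - a →
      HasOsc G (12 * (1 + H + M)) a b := by
    intro n
    induction n with
    | zero =>
      intro a b hab hl
      exact (h.hasOsc_of_large (by simpa using hl)).mono hab.le (by linarith)
    | succ n ih =>
      have ih' : ∀ a b : ℝ, a < b → 4 * (1 / 10 * (1 / 4 : ℝ) ^ (n + 1)) ≤ b - a →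
          HasOsc G (12 * (1 + H + M)) a b := by
        intro a b hab hl
        refine ih a b hab (le_trans (le_of_eq ?_) hl)
        ring
      intro a b hab hl
      rcases le_or_gt (1 / 10) (b - a) with hlarge | hsmall
      · exact (h.hasOsc_of_large hlarge).mono hab.le (by linarith)
      -- translate the left end point into `[0, 1)`
      refine HasOsc.of_translate h.periodic (-⌊a⌋) ?_
      have ha0 : 0 ≤ a + (-⌊a⌋ : ℤ) := by push_cast; linarith [Int.floor_le a]
      have ha1 : a + (-⌊a⌋ : ℤ) < 1 := by push_cast; linarith [Int.lt_floor_add_one a]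
      have hab' : a + (-⌊a⌋ : ℤ) < b + (-⌊a⌋ : ℤ) := by linarith
      have hs' : b + (-⌊a⌋ : ℤ) - (a + (-⌊a⌋ : ℤ)) ≤ 1 / 10 := by linarith
      have hl' : 1 / 10 * (1 / 4 : ℝ) ^ (n + 1) ≤ b + (-⌊a⌋ : ℤ) - (a + (-⌊a⌋ : ℤ)) := by
        linarith
      generalize a + ((-⌊a⌋ : ℤ) : ℝ) = p at *
      generalize b + ((-⌊a⌋ : ℤ) : ℝ) = q at *
      rcases ha0.eq_or_lt with rfl | hp0
      · exact (h.hasOsc_of_zero_mem le_rfl hab'.le hab' hs').mono hab'.le (by linarith)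
      rcases le_or_gt 1 q with hq | hq
      · refine HasOsc.of_translate h.periodic (-1) ?_
        push_cast
        exact (h.hasOsc_of_zero_mem (by linarith) (by linarith) (by linarith)
          (by linarith)).mono (by linarith) (by linarith)
      rcases lt_or_ge q (1 / 2) with hq2 | hq2
      · exact h.hasOsc_of_mem_Ioo ih' hp0 hab' hq2 hl'
      rcases le_or_gt p (1 / 2) with hp2 | hp2
      · exact (h.hasOsc_of_half_mem hp2 hq2 hab' hs').mono hab'.le (by linarith)
      · refine HasOsc.of_reflect h.reflect_one ?_
        exact h.hasOsc_of_mem_Ioo ih' (by linarith) (by linarith) (by linarith) (by linarith)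
  obtain ⟨n, hn⟩ := exists_pow_lt_of_lt_one (show 0 < b - a by linarith)
    (show (1 / 4 : ℝ) < 1 by norm_num)
  refine key n a b hab ?_
  have : 0 < (1 / 4 : ℝ) ^ n := by positivity
  linarith

end WiltonEquation

/-! ### The folding map -/

theorem alphaMap_eq_alphaFold (α x : ℝ) : alphaMap α x = alphaFold α (1 / x) := rfl

theorem alphaFold_periodic (α : ℝ) : Function.Periodic (alphaFold α) 1 := by
  intro x
  have : x + 1 - α + 1 = x - α + 1 + (1 : ℤ) := by push_cast; ring
  simp only [alphaFold, this, Int.floor_add_intCast]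
  congr 1
  push_cast
  ring

theorem alphaFold_add_intCast (α x : ℝ) (n : ℤ) : alphaFold α (x + n) = alphaFold α x := by
  simpa using (alphaFold_periodic α).int_mul n x

theorem alphaFold_of_mem {α x : ℝ} (h1 : α - 1 ≤ x) (h2 : x < α) : alphaFold α x = |x| := by
  have : ⌊x - α + 1⌋ = 0 := Int.floor_eq_zero_iff.2 ⟨by linarith, by linarith⟩
  simp [alphaFold, this]

theorem measurable_alphaFold (α : ℝ) : Measurable (alphaFold α) := by
  unfold alphaFold
  have : Measurable fun x : ℝ => ((⌊x - α + 1⌋ : ℤ) : ℝ) :=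
    measurable_from_top.comp (Int.measurable_floor.comp (by fun_prop))
  simp_rw [← Real.norm_eq_abs]
  exact (measurable_id.sub this).norm

theorem measurable_alphaMap (α : ℝ) : Measurable (alphaMap α) :=
  (measurable_alphaFold α).comp (measurable_const.div measurable_id)

theorem alphaFold_half_eq_min (x : ℝ) :
    alphaFold (1 / 2) x = min (Int.fract x) (1 - Int.fract x) := by
  rw [← abs_sub_round_eq_min, round_eq, alphaFold]
  congr 4
  ring

theorem alphaFold_half_neg (x : ℝ) : alphaFold (1 / 2) (-x) = alphaFold (1 / 2) x := by
  rw [alphaFold_half_eq_min, alphaFold_half_eq_min]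
  by_cases h : Int.fract x = 0
  · rw [h, Int.fract_neg_eq_zero.2 h]
  · rw [Int.fract_neg h, sub_sub_self, min_comm]

theorem alphaFold_half_of_abs_le {x : ℝ} (h : |x| ≤ 1 / 2) : alphaFold (1 / 2) x = |x| := by
  rw [abs_le] at h
  rcases h.2.eq_or_lt with rfl | h2
  · rw [← alphaFold_half_neg, alphaFold_of_mem (by norm_num) (by norm_num), abs_neg]
  · exact alphaFold_of_mem (by linarith) h2

/-- A period is folded onto `(0, α)` at most two to one. -/
theorem lintegral_comp_alphaFold_le {α : ℝ} (h1 : 1 / 2 ≤ α) (Φ : ℝ → ℝ≥0∞) :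
    ∫⁻ x in Ioc 0 1, Φ (alphaFold α x) ≤ 2 * ∫⁻ x in Ioc 0 α, Φ x := by
  have hp : Function.Periodic (fun x => Φ (alphaFold α x)) 1 :=
    fun x => by simp [alphaFold_periodic α x]
  have e := lintegral_Ioc_periodic_eq hp 0 (α - 1)
  rw [zero_add, sub_add_cancel] at e
  have r := setLIntegral_Icc_reflect (fun x => Φ |x|) 0 0 α
  simp only [zero_sub, abs_neg, neg_zero] at r
  have r2 : ∫⁻ x in Icc 0 α, Φ |x| = ∫⁻ x in Ioc 0 α, Φ x := by
    rw [setLIntegral_congr Ioc_ae_eq_Icc.symm]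
    exact setLIntegral_congr_fun measurableSet_Ioc fun x hx => by
      simp only [abs_of_pos hx.1]
  calc _ = ∫⁻ x in Ioc (α - 1) α, Φ (alphaFold α x) := e
    _ = ∫⁻ x in Ico (α - 1) α, Φ (alphaFold α x) := setLIntegral_congr Ico_ae_eq_Ioc.symm
    _ = ∫⁻ x in Ico (α - 1) α, Φ |x| :=
        setLIntegral_congr_fun measurableSet_Ico fun x hx => by
          simp only [alphaFold_of_mem hx.1 hx.2]
    _ ≤ ∫⁻ x in Icc (-α) 0 ∪ Icc 0 α, Φ |x| := by
        refine lintegral_mono_set fun x hx => ?_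
        rcases le_total x 0 with h | h
        · exact Or.inl ⟨by linarith [hx.1], h⟩
        · exact Or.inr ⟨h, hx.2.le⟩
    _ ≤ _ := lintegral_union_le _ _ _
    _ = _ := by rw [r, r2, two_mul]

/-! ### The series and its functional equation -/

/-- The `n`-th summand of the series that defines the `α`-Wilton function. -/
noncomputable def wiltonTerm (α : ℝ) (n : ℕ) (x : ℝ) : ℝ :=
  (-1 : ℝ) ^ n * alphaBeta α n x * Real.log (1 / (alphaMap α)^[n] x)

/-- The sum of the series that defines the `α`-Wilton function, at the point `x` itself. -/
noncomputable def wiltonSum (α x : ℝ) : ℝ :=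
  limUnder atTop (fun N : ℕ => wiltonPartialSum α N x)

/-- Convergence of the series that defines the `α`-Wilton function, at the point `x` itself. -/
def WiltonConverges (α x : ℝ) : Prop :=
  ∃ l : ℝ, Tendsto (fun N : ℕ => wiltonPartialSum α N x) atTop (𝓝 l)

theorem wilton_eq (α x : ℝ) : wilton α x = wiltonSum α (alphaFold α x) := rfl

theorem WiltonConverges.tendsto {α x : ℝ} (h : WiltonConverges α x) :
    Tendsto (fun N : ℕ => wiltonPartialSum α N x) atTop (𝓝 (wiltonSum α x)) :=
  tendsto_nhds_limUnder h

theorem alphaBeta_succ (α : ℝ) (n : ℕ) (x : ℝ) :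
    alphaBeta α (n + 1) x = x * alphaBeta α n (alphaMap α x) := by
  simp only [alphaBeta, Finset.prod_range_succ', Function.iterate_succ_apply,
    Function.iterate_zero, id]
  ring

theorem wiltonTerm_succ (α : ℝ) (n : ℕ) (x : ℝ) :
    wiltonTerm α (n + 1) x = -(x * wiltonTerm α n (alphaMap α x)) := by
  simp only [wiltonTerm, alphaBeta_succ, Function.iterate_succ_apply]
  ring

theorem wiltonPartialSum_eq_sum (α : ℝ) (N : ℕ) (x : ℝ) :
    wiltonPartialSum α N x = ∑ n ∈ Finset.range N, wiltonTerm α n x := rfl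

theorem wiltonPartialSum_succ (α : ℝ) (N : ℕ) (x : ℝ) :
    wiltonPartialSum α (N + 1) x = -Real.log x - x * wiltonPartialSum α N (alphaMap α x) := by
  have h0 : wiltonTerm α 0 x = -Real.log x := by simp [wiltonTerm, alphaBeta]
  simp only [wiltonPartialSum_eq_sum, Finset.sum_range_succ', h0, wiltonTerm_succ,
    Finset.mul_sum, Finset.sum_neg_distrib]
  ring

theorem WiltonConverges.of_alphaMap {α x : ℝ} (h : WiltonConverges α (alphaMap α x)) :
    WiltonConverges α x := by
  refine ⟨-Real.log x - x * wiltonSum α (alphaMap α x), (tendsto_add_atTop_iff_nat 1).1 ?_⟩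
  simp only [wiltonPartialSum_succ]
  exact (h.tendsto.const_mul x).const_sub _

theorem WiltonConverges.map {α x : ℝ} (h : WiltonConverges α x) (hx : x ≠ 0) :
    WiltonConverges α (alphaMap α x) := by
  refine ⟨(-Real.log x - wiltonSum α x) / x, ?_⟩
  have h1 := (((tendsto_add_atTop_iff_nat 1).2 h.tendsto).const_sub (-Real.log x)).div_const x
  simp only [wiltonPartialSum_succ] at h1
  refine h1.congr fun N => ?_
  field_simp
  ring

/-- The functional equation `W(x) = - log x - x W(A_α(x))`. -/
theorem WiltonConverges.wiltonSum_eq {α x : ℝ} (h : WiltonConverges α (alphaMap α x)) :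
    wiltonSum α x = -Real.log x - x * wiltonSum α (alphaMap α x) := by
  refine tendsto_nhds_unique ((tendsto_add_atTop_iff_nat 1).2 h.of_alphaMap.tendsto) ?_
  simp only [wiltonPartialSum_succ]
  exact (h.tendsto.const_mul x).const_sub _

theorem measurable_wiltonTerm (α : ℝ) (n : ℕ) : Measurable (wiltonTerm α n) := by
  have hi : ∀ i : ℕ, Measurable (alphaMap α)^[i] := fun i => (measurable_alphaMap α).iterate i
  have hb : Measurable (alphaBeta α n) := by
    unfold alphaBeta
    exact Finset.measurable_prod _ fun i _ => hi i
  unfold wiltonTerm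
  exact (hb.const_mul _).mul (Real.measurable_log.comp (measurable_const.div (hi n)))

theorem measurable_wiltonSum (α : ℝ) : Measurable (wiltonSum α) := by
  refine (StronglyMeasurable.limUnder fun N => Measurable.stronglyMeasurable ?_).measurable
  change Measurable fun x => ∑ n ∈ Finset.range N, wiltonTerm α n x
  exact Finset.measurable_sum _ fun n _ => measurable_wiltonTerm α n

theorem measurable_wilton (α : ℝ) : Measurable (wilton α) :=
  (measurable_wiltonSum α).comp (measurable_alphaFold α)

theorem wilton_periodic (α : ℝ) : Function.Periodic (wilton α) 1 := fun x => by
  simp only [wilton_eq, alphaFold_periodic α x]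

theorem le_five_eighths {α : ℝ} (hαg : α ≤ (Real.sqrt 5 - 1) / 2) : α ≤ 5 / 8 := by
  have : Real.sqrt 5 ≤ 9 / 4 := Real.sqrt_le_iff.2 ⟨by norm_num, by norm_num⟩
  linarith

theorem sq_add_self_le_one {α : ℝ} (hα : 1 / 2 ≤ α) (hαg : α ≤ (Real.sqrt 5 - 1) / 2) :
    α ^ 2 + α ≤ 1 := by
  nlinarith [Real.sq_sqrt (show (0 : ℝ) ≤ 5 by norm_num), Real.sqrt_nonneg 5]

/-! ### Convergence almost everywhere and integrability -/

/-- The operator `f ↦ x f(A_α(x))` contracts the `L¹` norm. -/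
theorem lintegral_wiltonTerm_succ_le {α : ℝ} (h1 : 1 / 2 ≤ α) (h2 : α ≤ 5 / 8) (n : ℕ) :
    ∫⁻ x in Ioc 0 1, ‖wiltonTerm α (n + 1) (alphaFold α x)‖ₑ ≤
      ENNReal.ofReal (3 / 4) * ∫⁻ x in Ioc 0 1, ‖wiltonTerm α n (alphaFold α x)‖ₑ := by
  have h0 : 0 < α := by linarith
  have hp : Function.Periodic (fun x => ‖wiltonTerm α n (alphaFold α x)‖ₑ) 1 :=
    fun x => by simp [alphaFold_periodic α x]
  calc _ ≤ 2 * ∫⁻ x in Ioc 0 α, ‖wiltonTerm α (n + 1) x‖ₑ :=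
        lintegral_comp_alphaFold_le h1 fun x => ‖wiltonTerm α (n + 1) x‖ₑ
    _ = 2 * ∫⁻ x in Ioc 0 α, ENNReal.ofReal x * ‖wiltonTerm α n (alphaFold α (1 / x))‖ₑ := by
        congr 1
        refine setLIntegral_congr_fun measurableSet_Ioc fun x hx => ?_
        simp only [wiltonTerm_succ, enorm_neg, enorm_mul, alphaMap_eq_alphaFold]
        rw [Real.enorm_eq_ofReal hx.1.le]
    _ = 2 * ∫⁻ y in (fun x : ℝ => x⁻¹) '' Ioc 0 α,
          ENNReal.ofReal ((y ^ 3)⁻¹) * ‖wiltonTerm α n (alphaFold α y)‖ₑ := by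
        rw [lintegral_mul_comp_inv (fun x => ‖wiltonTerm α n (alphaFold α x)‖ₑ)
          measurableSet_Ioc fun x hx => hx.1]
    _ ≤ 2 * ∫⁻ y in Ici α⁻¹, ENNReal.ofReal ((y ^ 3)⁻¹) * ‖wiltonTerm α n (alphaFold α y)‖ₑ := by
        gcongr
        rintro _ ⟨x, hx, rfl⟩
        exact inv_anti₀ hx.1 hx.2
    _ = 2 * ∫⁻ y in Ioi α⁻¹, ENNReal.ofReal ((y ^ 3)⁻¹) * ‖wiltonTerm α n (alphaFold α y)‖ₑ := by
        rw [setLIntegral_congr Ioi_ae_eq_Ici.symm]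
    _ ≤ 2 * (ENNReal.ofReal (3 / 8) * ∫⁻ x in Ioc 0 1, ‖wiltonTerm α n (alphaFold α x)‖ₑ) := by
        gcongr
        refine (lintegral_Ioi_inv_cube_mul_le hp (inv_pos.2 h0)).trans ?_
        gcongr
        have e1 : ((α⁻¹) ^ 3)⁻¹ = α ^ 3 := by simp
        have e2 : 1 / (2 * α⁻¹ * (α⁻¹ + 1)) ≤ α ^ 2 / 3 := by
          have : 1 / (2 * α⁻¹ * (α⁻¹ + 1)) = α ^ 2 / (2 * (1 + α)) := by field_simp
          rw [this]
          exact div_le_div_of_nonneg_left (by positivity) (by norm_num) (by linarith)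
        have e3 : α ^ 2 ≤ (5 / 8) ^ 2 := by gcongr
        have e4 : α ^ 3 ≤ (5 / 8) ^ 3 := by gcongr
        rw [e1]
        linarith
    _ = _ := by
        rw [← mul_assoc]
        congr 1
        rw [show (2 : ℝ≥0∞) = ENNReal.ofReal 2 by simp, ← ENNReal.ofReal_mul (by norm_num)]
        norm_num

theorem lintegral_wiltonTerm_zero_lt_top {α : ℝ} (h1 : 1 / 2 ≤ α) :
    ∫⁻ x in Ioc 0 1, ‖wiltonTerm α 0 (alphaFold α x)‖ₑ < ∞ := by
  refine (lintegral_comp_alphaFold_le h1 fun x => ‖wiltonTerm α 0 x‖ₑ).trans_lt ?_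
  refine ENNReal.mul_lt_top (by simp) ?_
  have h0 : ∀ x, wiltonTerm α 0 x = -Real.log x := fun x => by simp [wiltonTerm, alphaBeta]
  simp only [h0, enorm_neg]
  have hi : IntervalIntegrable Real.log volume 0 α := intervalIntegral.intervalIntegrable_log'
  exact ((intervalIntegrable_iff_integrableOn_Ioc_of_le (by linarith)).1 hi).hasFiniteIntegral

theorem lintegral_tsum_wiltonTerm_lt_top {α : ℝ} (h1 : 1 / 2 ≤ α) (h2 : α ≤ 5 / 8) :
    ∫⁻ x in Ioc 0 1, ∑' n, ‖wiltonTerm α n (alphaFold α x)‖ₑ < ∞ := by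
  have hm : ∀ n, Measurable fun x => ‖wiltonTerm α n (alphaFold α x)‖ₑ := fun n =>
    ((measurable_wiltonTerm α n).comp (measurable_alphaFold α)).enorm
  rw [lintegral_tsum fun n => (hm n).aemeasurable]
  have key : ∀ n : ℕ, ∫⁻ x in Ioc 0 1, ‖wiltonTerm α n (alphaFold α x)‖ₑ ≤
      ENNReal.ofReal (3 / 4) ^ n * ∫⁻ x in Ioc 0 1, ‖wiltonTerm α 0 (alphaFold α x)‖ₑ := by
    intro n
    induction n with
    | zero => simp
    | succ n ih =>
      refine (lintegral_wiltonTerm_succ_le h1 h2 n).trans ?_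
      rw [pow_succ', mul_assoc]
      gcongr
  refine (ENNReal.tsum_le_tsum key).trans_lt ?_
  rw [ENNReal.tsum_mul_right, ENNReal.tsum_geometric]
  refine ENNReal.mul_lt_top ?_ (lintegral_wiltonTerm_zero_lt_top h1)
  rw [ENNReal.inv_lt_top, tsub_pos_iff_lt, ENNReal.ofReal_lt_one]
  norm_num

theorem ae_tsum_wiltonTerm_lt_top {α : ℝ} (h1 : 1 / 2 ≤ α) (h2 : α ≤ 5 / 8) :
    ∀ᵐ x : ℝ, ∑' n, ‖wiltonTerm α n (alphaFold α x)‖ₑ < ∞ := by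
  have hp : Function.Periodic (fun x => ∑' n, ‖wiltonTerm α n (alphaFold α x)‖ₑ) 1 :=
    fun x => by simp [alphaFold_periodic α x]
  have hm : Measurable fun x => ∑' n, ‖wiltonTerm α n (alphaFold α x)‖ₑ :=
    Measurable.tsum fun n =>
      ((measurable_wiltonTerm α n).comp (measurable_alphaFold α)).enorm
  have h : ∀ k : ℤ, ∀ᵐ x ∂volume.restrict (Ioc (k : ℝ) (k + 1)),
      ∑' n, ‖wiltonTerm α n (alphaFold α x)‖ₑ < ∞ := by
    intro k
    refine ae_lt_top hm ?_
    rw [lintegral_Ioc_periodic_eq hp k 0, zero_add]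
    exact (lintegral_tsum_wiltonTerm_lt_top h1 h2).ne
  rw [← Measure.restrict_univ (μ := (volume : Measure ℝ)), ← iUnion_Ioc_intCast ℝ]
  exact (ae_restrict_iUnion_iff _ _).2 h

theorem summable_wiltonTerm {α x : ℝ} (h : ∑' n, ‖wiltonTerm α n x‖ₑ < ∞) :
    Summable fun n => wiltonTerm α n x :=
  Summable.of_nnnorm (ENNReal.tsum_coe_ne_top_iff_summable.1 h.ne)

theorem wiltonConverges_of_tsum_lt_top {α x : ℝ} (h : ∑' n, ‖wiltonTerm α n x‖ₑ < ∞) :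
    WiltonConverges α x :=
  ⟨_, (summable_wiltonTerm h).hasSum.tendsto_sum_nat⟩

theorem enorm_wiltonSum_le {α x : ℝ} (h : ∑' n, ‖wiltonTerm α n x‖ₑ < ∞) :
    ‖wiltonSum α x‖ₑ ≤ ∑' n, ‖wiltonTerm α n x‖ₑ := by
  have e : wiltonSum α x = ∑' n, wiltonTerm α n x :=
    tendsto_nhds_unique (wiltonConverges_of_tsum_lt_top h).tendsto
      (summable_wiltonTerm h).hasSum.tendsto_sum_nat
  rw [e]
  exact enorm_tsum_le_tsum_enorm

theorem ae_wiltonConverges {α : ℝ} (h1 : 1 / 2 ≤ α) (h2 : α ≤ 5 / 8) :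
    ∀ᵐ x : ℝ, WiltonConverges α (alphaFold α x) :=
  (ae_tsum_wiltonTerm_lt_top h1 h2).mono fun _ hx => wiltonConverges_of_tsum_lt_top hx

theorem lintegral_wilton_lt_top {α : ℝ} (h1 : 1 / 2 ≤ α) (h2 : α ≤ 5 / 8) :
    ∫⁻ x in Ioc 0 1, ‖wilton α x‖ₑ < ∞ := by
  refine lt_of_le_of_lt (lintegral_mono_ae (ae_restrict_of_ae ?_))
    (lintegral_tsum_wiltonTerm_lt_top h1 h2)
  filter_upwards [ae_tsum_wiltonTerm_lt_top h1 h2] with x hx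
  exact enorm_wiltonSum_le hx

/-! ### Comparison with an even function -/

/-- For `1 / 2 < x < α` the second iterates of `x` and `1 - x` coincide, and so do the products
`x A_α(x) = 2 x - 1 = (1 - x) A_α(1 - x)`. Hence the tails of the two series cancel. This uses
`α² + α ≤ 1`. -/
theorem abs_wiltonSum_sub_reflect_le {α x : ℝ} (hα : 1 / 2 ≤ α) (hα2 : α ≤ 5 / 8)
    (hg : α ^ 2 + α ≤ 1) (hx1 : 1 / 2 < x) (hx2 : x < α) (hx : WiltonConverges α x) :
    |wiltonSum α x - wiltonSum α (1 - x)| ≤ 7 := by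
  have hx0 : 0 < x := by linarith
  have hy0 : 0 < 1 - x := by linarith
  have hd : 0 < 2 * x - 1 := by linarith
  have hA : alphaMap α x = (2 * x - 1) / x := by
    have e : 1 / x = (1 / x - 2) + (2 : ℤ) := by push_cast; ring
    have e2 : 1 / x - 2 = -((2 * x - 1) / x) := by field_simp; ring
    rw [alphaMap_eq_alphaFold, e, alphaFold_add_intCast, alphaFold_of_mem, e2, abs_neg,
      abs_of_pos (by positivity)]
    · have : 1 + α ≤ 1 / x := by
        rw [le_div_iff₀ hx0]
        nlinarith
      linarith
    · rw [e2]
      have : 0 < (2 * x - 1) / x := by positivity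
      linarith
  have hA' : alphaMap α (1 - x) = (2 * x - 1) / (1 - x) := by
    have e : 1 / (1 - x) = (1 / (1 - x) - 2) + (2 : ℤ) := by push_cast; ring
    have e2 : 1 / (1 - x) - 2 = (2 * x - 1) / (1 - x) := by field_simp; ring
    have hpos : 0 < (2 * x - 1) / (1 - x) := by positivity
    rw [alphaMap_eq_alphaFold, e, alphaFold_add_intCast, alphaFold_of_mem, e2, abs_of_pos hpos]
    · rw [e2]
      linarith
    · have : 1 / (1 - x) < 2 + α := by
        rw [div_lt_iff₀ hy0]
        nlinarith
      linarith
  have hAA : alphaMap α (alphaMap α (1 - x)) = alphaMap α (alphaMap α x) := by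
    rw [hA, hA', alphaMap_eq_alphaFold, alphaMap_eq_alphaFold, ← alphaFold_periodic α]
    congr 1
    field_simp
    ring
  have hA0 : alphaMap α x ≠ 0 := by rw [hA]; positivity
  have hc1 := hx.map hx0.ne'
  have hc2 := hc1.map hA0
  have hc2' : WiltonConverges α (alphaMap α (alphaMap α (1 - x))) := by rwa [hAA]
  have hc1' := hc2'.of_alphaMap
  have hV : wiltonSum α x = -Real.log x - x * (-Real.log (alphaMap α x) -
      alphaMap α x * wiltonSum α (alphaMap α (alphaMap α x))) := by
    rw [hc1.wiltonSum_eq, hc2.wiltonSum_eq]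
  have hV' : wiltonSum α (1 - x) = -Real.log (1 - x) - (1 - x) *
      (-Real.log (alphaMap α (1 - x)) -
      alphaMap α (1 - x) * wiltonSum α (alphaMap α (alphaMap α x))) := by
    rw [hc1'.wiltonSum_eq, hc2'.wiltonSum_eq, hAA]
  generalize wiltonSum α (alphaMap α (alphaMap α x)) = v at hV hV'
  rw [hA, Real.log_div hd.ne' hx0.ne'] at hV
  rw [hA', Real.log_div hd.ne' hy0.ne'] at hV'
  have e : wiltonSum α x - wiltonSum α (1 - x) = -Real.log x + Real.log (1 - x) -
      Real.log x * x + Real.log (1 - x) * (1 - x) + Real.log (2 * x - 1) * (2 * x - 1) := by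
    rw [hV, hV']
    field_simp
    ring
  have b1 := abs_lt.1 (Real.abs_log_mul_self_lt x hx0 (by linarith))
  have b2 := abs_lt.1 (Real.abs_log_mul_self_lt (1 - x) hy0 (by linarith))
  have b3 := abs_lt.1 (Real.abs_log_mul_self_lt (2 * x - 1) hd (by linarith))
  have c1 := Real.log_nonpos hx0.le (by linarith)
  have c2 := Real.log_nonpos hy0.le (by linarith)
  have d1 : -2 ≤ Real.log x := by
    have := Real.one_sub_inv_le_log_of_pos hx0
    have h3 : x⁻¹ ≤ 3 := by
      rw [inv_le_comm₀ hx0 (by norm_num)]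
      linarith
    linarith
  have d2 : -2 ≤ Real.log (1 - x) := by
    have := Real.one_sub_inv_le_log_of_pos hy0
    have h3 : (1 - x)⁻¹ ≤ 3 := by
      rw [inv_le_comm₀ hy0 (by norm_num)]
      linarith
    linarith
  rw [e, abs_le]
  constructor <;> linarith

/-- The even function of period `1` that agrees with the `α`-Wilton function on `(0, 1 / 2)`. -/
noncomputable def evenWilton (α x : ℝ) : ℝ := wiltonSum α (alphaFold (1 / 2) x)

theorem abs_wilton_sub_evenWilton_le {α y : ℝ} (hα : 1 / 2 ≤ α) (hα2 : α ≤ 5 / 8)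
    (hg : α ^ 2 + α ≤ 1) (hy : WiltonConverges α (alphaFold α y)) :
    |wilton α y - evenWilton α y| ≤ 7 := by
  have h1 := Int.floor_le (y - α + 1)
  have h2 := Int.lt_floor_add_one (y - α + 1)
  have e : y = (y - ⌊y - α + 1⌋) + (⌊y - α + 1⌋ : ℤ) := by ring
  have hx1 : α - 1 ≤ y - ⌊y - α + 1⌋ := by linarith
  have hx2 : y - ⌊y - α + 1⌋ < α := by linarith
  have hf : alphaFold α y = |y - ⌊y - α + 1⌋| := rfl
  have hf2 : alphaFold (1 / 2) y = alphaFold (1 / 2) (y - ⌊y - α + 1⌋) := by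
    conv_lhs => rw [e]
    exact alphaFold_add_intCast _ _ _
  rw [wilton_eq, evenWilton, hf2]
  rw [hf] at hy ⊢
  generalize y - (⌊y - α + 1⌋ : ℝ) = x at *
  rcases le_or_gt x (1 / 2) with hx | hx
  · rw [alphaFold_half_of_abs_le (abs_le.2 ⟨by linarith, hx⟩), sub_self, abs_zero]
    norm_num
  · have hx0 : |x| = x := abs_of_pos (by linarith)
    have hr : alphaFold (1 / 2) x = 1 - x := by
      rw [← alphaFold_half_neg, ← alphaFold_periodic, alphaFold_half_of_abs_le, abs_of_pos]
      · ring
      · linarith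
      · rw [abs_le]
        constructor <;> linarith
    rw [hr, hx0]
    rw [hx0] at hy
    exact abs_wiltonSum_sub_reflect_le hα hα2 hg hx hx2 hy

theorem lintegral_evenWilton_lt_top {α : ℝ} (h1 : 1 / 2 ≤ α) (h2 : α ≤ 5 / 8) :
    ∫⁻ x in Ioc 0 1, ‖evenWilton α x‖ₑ < ∞ := by
  refine (lintegral_comp_alphaFold_le le_rfl fun x => ‖wiltonSum α x‖ₑ).trans_lt ?_
  refine ENNReal.mul_lt_top (by simp) (lt_of_le_of_lt ?_ (lintegral_wilton_lt_top h1 h2))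
  calc ∫⁻ x in Ioc 0 (1 / 2), ‖wiltonSum α x‖ₑ = ∫⁻ x in Ioo 0 (1 / 2), ‖wiltonSum α x‖ₑ :=
        setLIntegral_congr Ioo_ae_eq_Ioc.symm
    _ = ∫⁻ x in Ioo 0 (1 / 2), ‖wilton α x‖ₑ :=
        setLIntegral_congr_fun measurableSet_Ioo fun x hx => by
          simp only [wilton_eq]
          rw [alphaFold_of_mem (by linarith [hx.1]) (by linarith [hx.2]), abs_of_pos hx.1]
    _ ≤ _ := lintegral_mono_set (Ioo_subset_Ioc_self.trans (Ioc_subset_Ioc_right (by norm_num)))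

theorem wiltonEquation_evenWilton {α : ℝ} (hα : 1 / 2 ≤ α) (hα2 : α ≤ 5 / 8)
    (hg : α ^ 2 + α ≤ 1) :
    WiltonEquation (evenWilton α) (∫⁻ x in Ioc 0 1, ‖evenWilton α x‖ₑ).toReal 7 where
  measurable := (measurable_wiltonSum α).comp (measurable_alphaFold _)
  periodic x := by simp only [evenWilton, alphaFold_periodic (1 / 2) x]
  even x := by simp only [evenWilton, alphaFold_half_neg]
  nonneg_M := ENNReal.toReal_nonneg
  nonneg_H := by norm_num
  lintegral_le := by rw [ENNReal.ofReal_toReal (lintegral_evenWilton_lt_top hα hα2).ne]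
  equation := by
    filter_upwards [ae_wiltonConverges hα hα2] with t ht htI
    have ht0 : 0 < t := htI.1
    have hf : alphaFold α t = t := by
      rw [alphaFold_of_mem (by linarith) (by linarith [htI.2]), abs_of_pos ht0]
    have hf2 : alphaFold (1 / 2) t = t := by
      rw [alphaFold_of_mem (by linarith) htI.2, abs_of_pos ht0]
    rw [hf] at ht
    have hc := ht.map ht0.ne'
    have hdiff := abs_wilton_sub_evenWilton_le hα hα2 hg hc
    have e : evenWilton α t = -Real.log t - t * wilton α (1 / t) := by
      rw [evenWilton, hf2]
      exact hc.wiltonSum_eq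
    have e2 : evenWilton α t + Real.log t + t * evenWilton α (1 / t) =
        -(t * (wilton α (1 / t) - evenWilton α (1 / t))) := by rw [e]; ring
    rw [e2, abs_neg, abs_mul, abs_of_pos ht0]
    nlinarith [htI.2, abs_nonneg (wilton α (1 / t) - evenWilton α (1 / t))]

/-! ### Bounded mean oscillation of the Wilton function -/

theorem locallyIntegrable_of_periodic {f : ℝ → ℝ} (hf : Measurable f)
    (hp : Function.Periodic f 1) (hi : ∫⁻ x in Ioc 0 1, ‖f x‖ₑ < ∞) :
    LocallyIntegrable f volume := by
  rw [locallyIntegrable_iff]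
  intro k hk
  obtain ⟨r, hr⟩ := hk.isBounded.subset_closedBall 0
  rw [Real.closedBall_eq_Icc] at hr
  refine IntegrableOn.mono_set (t := Icc (-|r|) |r|) ⟨hf.aestronglyMeasurable, ?_⟩
    (hr.trans (Icc_subset_Icc (by linarith [le_abs_self r]) (by linarith [le_abs_self r])))
  have hpe : Function.Periodic (fun x => ‖f x‖ₑ) 1 := fun x => by simp [hp x]
  rw [hasFiniteIntegral_iff_enorm, setLIntegral_congr Ioc_ae_eq_Icc.symm]
  exact (lintegral_Ioc_periodic_le hpe (by linarith [abs_nonneg r])).trans_lt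
    (ENNReal.mul_lt_top ENNReal.ofReal_lt_top hi)

/-- Replacing the constant by the mean value at most doubles the mean oscillation. -/
theorem HasOsc.meanValue_abs_sub_le {f : ℝ → ℝ} {K a b : ℝ} (hf : LocallyIntegrable f volume)
    (hab : a < b) (hK : 0 ≤ K) (h : HasOsc f K a b) :
    meanValue (fun x => |f x - meanValue f a b|) a b ≤ 2 * K := by
  obtain ⟨c, hc⟩ := h
  have hba : 0 < b - a := by linarith
  have hfi : IntervalIntegrable f volume a b :=
    (hf.integrableOn_isCompact isCompact_uIcc).intervalIntegrable
  have hci : IntervalIntegrable (fun x => |f x - c|) volume a b :=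
    (hfi.sub intervalIntegrable_const).abs
  have h1 : ∫ x in a..b, |f x - c| ≤ K * (b - a) := by
    rw [intervalIntegral.integral_of_le hab.le, ← integral_Icc_eq_integral_Ioc]
    rw [← ENNReal.ofReal_le_ofReal_iff (by positivity), ofReal_integral_eq_lintegral_ofReal]
    · simpa only [Real.enorm_eq_ofReal_abs] using hc
    · exact (integrableOn_Icc_iff_integrableOn_Ioc (by simp)).2
        ((intervalIntegrable_iff_integrableOn_Ioc_of_le hab.le).1 hci)
    · exact ae_of_all _ fun x => abs_nonneg _
  have h2 : |meanValue f a b - c| * (b - a) ≤ K * (b - a) := by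
    have e : (meanValue f a b - c) * (b - a) = ∫ x in a..b, (f x - c) := by
      rw [intervalIntegral.integral_sub hfi intervalIntegrable_const,
        intervalIntegral.integral_const, meanValue, smul_eq_mul]
      field_simp
    rw [← abs_of_pos hba, ← abs_mul, abs_of_pos hba, e]
    exact (intervalIntegral.abs_integral_le_integral_abs hab.le).trans h1
  have h3 : ∫ x in a..b, |f x - meanValue f a b| ≤
      ∫ x in a..b, (|f x - c| + |meanValue f a b - c|) := by
    refine intervalIntegral.integral_mono_on hab.le (hfi.sub intervalIntegrable_const).abs
      (hci.add intervalIntegrable_const) fun x _ => ?_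
    rw [abs_sub_comm (meanValue f a b) c]
    exact abs_sub_le _ _ _
  rw [intervalIntegral.integral_add hci intervalIntegrable_const,
    intervalIntegral.integral_const, smul_eq_mul] at h3
  rw [meanValue, one_div, inv_mul_le_iff₀ hba]
  linarith

/-- Mean oscillation is stable under bounded perturbations. -/
theorem HasOsc.of_ae_abs_sub_le {f g : ℝ → ℝ} {K B a b : ℝ} (hab : a ≤ b) (hK : 0 ≤ K)
    (hB : 0 ≤ B) (hfg : ∀ᵐ x : ℝ, |f x - g x| ≤ B) (h : HasOsc g K a b) :
    HasOsc f (B + K) a b := by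
  obtain ⟨c, hc⟩ := h
  refine ⟨c, ?_⟩
  have hba : 0 ≤ b - a := by linarith
  calc ∫⁻ x in Icc a b, ‖f x - c‖ₑ ≤ ∫⁻ x in Icc a b, (ENNReal.ofReal B + ‖g x - c‖ₑ) := by
        refine lintegral_mono_ae (ae_restrict_of_ae ?_)
        filter_upwards [hfg] with x hx
        rw [← sub_add_sub_cancel (f x) (g x) c]
        exact (enorm_add_le _ _).trans (by gcongr; exact enorm_le_ofReal hx)
    _ = ENNReal.ofReal B * ENNReal.ofReal (b - a) + ∫⁻ x in Icc a b, ‖g x - c‖ₑ := by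
        rw [lintegral_add_left measurable_const, setLIntegral_const, Real.volume_Icc]
    _ ≤ ENNReal.ofReal B * ENNReal.ofReal (b - a) + ENNReal.ofReal (K * (b - a)) := by gcongr
    _ = _ := by
        rw [← ENNReal.ofReal_mul hB, ← ENNReal.ofReal_add (by positivity) (by positivity),
          add_mul]

theorem mainTheorem1 (α : ℝ) (hα : 1 / 2 ≤ α) (hαg : α ≤ (Real.sqrt 5 - 1) / 2) :
    (∀ᵐ x : ℝ, Tendsto (fun N : ℕ => wiltonPartialSum α N (alphaFold α x)) atTop
      (𝓝 (wilton α x))) ∧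
    IsBMO (wilton α) := by
  have hα2 := le_five_eighths hαg
  have hg := sq_add_self_le_one hα hαg
  have hconv := ae_wiltonConverges hα hα2
  have hloc := locallyIntegrable_of_periodic (measurable_wilton α) (wilton_periodic α)
    (lintegral_wilton_lt_top hα hα2)
  have heq := wiltonEquation_evenWilton hα hα2 hg
  have hM := heq.nonneg_M
  refine ⟨hconv.mono fun x hx => hx.tendsto, hloc,
    2 * (7 + 12 * (1 + 7 + (∫⁻ x in Ioc 0 1, ‖evenWilton α x‖ₑ).toReal)), fun a b hab => ?_⟩
  exact HasOsc.meanValue_abs_sub_le hloc hab (by positivity)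
    (HasOsc.of_ae_abs_sub_le hab.le (by positivity) (by norm_num)
      (hconv.mono fun x hx => abs_wilton_sub_evenWilton_le hα hα2 hg hx) (heq.hasOsc hab))
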